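/- **Setting.** Let $\zeta_1,\zeta_2,\dots$ be real random variables (test statistics) on one probability space. For each $i$ let $(Q_{i,\theta})_{\theta\in\Theta}$, $\Theta\subseteq\mathbb R$, be a family of probability measures on $\mathbb R$ such that $\zeta_i$ has law $Q_{i,\mu_i}$ for some $\mu_i\in\Theta$. Fix $\mu_0\in\Theta$; the $i$th null hypothesis is $\mu_i=\mu_0$. Let $F_i$ be the CDF of $Q_{i,\mu_0}$, let $p_i=1-F_i(\zeta_i)$, and for $t\in[0,1]$ put $$R_m(t)=\sum_{i=1}^m 1\{p_i\le t\},\qquad V_m(t)=\sum_{i\in I_{0,m}}1\{p_i\le t\},\qquad I_{0,m}=\{i\le m:\mu_i=\mu_0\},\quad m_0=|I_{0,m}|.$$ Let $\rho_{ij}$ be the correlation of $\zeta_i$ and $\zeta_j$, and $\|\mathbf R\|_1=\sum_{i,j=1}^m|\rho_{ij}|$. **Lancaster distributions.** Write $(a)_n=a(a+1)\cdots(a+n-1)$, $$L_n^{(a)}(x)=\sum_{k=0}^n\binom{n+a}{n-k}\frac{(-x)^k}{k!},\qquad C_n(x;a)=\sqrt{\tfrac{a^n}{n!}}\sum_{k=0}^n(-1)^k\binom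 nk\binom xk\frac{k!}{a^k},$$ $$M_n^{\beta,c}(x)=\sqrt{\tfrac{c^n(\beta)_n}{n!}}\sum_{k=0}^n\frac{(-n)_k(-x)_k}{(\beta)_k\,k!}(1-c^{-1})^k,$$ and $g(y;\alpha)=y^{\alpha-1}e^{-y}/\Gamma(\alpha)$ for $y>0$, $\pi(x;a)=a^xe^{-a}/x!$ and $f(x;\beta,c)=(1-c)^\beta c^x(\beta)_x/x!$ for $x\in\mathbb N_0$. A pair $(X,Y)$ has, with correlation $\rho$, 1. the Lancaster bivariate gamma distribution with shape $\alpha$ if $\rho\in[0,1)$ and its density on $(0,\infty)^2$ is $g(x;\alpha)g(y;\alpha)\sum_{n\ge0}\rho^n\frac{n!\,\Gamma(\alpha)}{\Gamma(\alpha+n)}L_n^{(\alpha-1)}(x)L_n^{(\alpha-1)}(y)$; 2. the Lancaster bivariate Poisson distribution with parameter $a$ if $\rho\in[0,1]$ and its probability mass function on $\mathbb N_0^2$ is $\pi(x;a)\pi(y;a)\sum_{n\ge0}\rho^nC_n(x;a)C_n(y;a)$; 3. the Lancaster bivariate negative binomial distribution with parameter $(\beta,c)$ if $\rho\in[0,1)$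 and its probability mass function on $\mathbb N_0^2$ is $f(x;\beta,c)f(y;\beta,c)\sum_{n\ge0}\rho^nM_n^{\beta,c}(x)M_n^{\beta,c}(y)$; 4. the Lancaster bivariate gamma–negative binomial distribution with parameter $(\beta,c,\alpha)$ if $\rho\in[0,\sqrt c]$ and its density with respect to (counting measure on $\mathbb N_0$)$\,\times\,$(Lebesgue measure on $(0,\infty)$) is $f(x;\beta,c)g(y;\alpha)\sum_{n\ge0}\rho^n\sqrt{\frac{n!}{(\alpha)_n}}\,L_n^{(\alpha-1)}(y)M_n^{\beta,c}(x)$ (it being understood that the function in question is a probability density). **Theorem.** For every $t\in[0,1]$ there is a constant $C>0$ such that the following holds in every setting as above in which each pair $(\zeta_i,\zeta_j)$, $i\ne j$, follows, in one of its two orders, one of the distributions: 1 with some $\alpha\in(0,1]$; 2 with some $a>0$; 3 with some $\beta>0$, $0<c<1$; 4 with some $\beta>0$, $0<c<1$, $\alpha>0$; in each case with correlation $\rho_{ij}$. (a) $\left|\mathrm{cov}\left(1\{p_i\le t\},1\{p_j\le t\}\right)\right|\le C|\rho_{ij}|$ for all $i\ne j$. (b) If $m^{-2}\|\mathbf R\|_1=O(m^{-\delta})$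 as $m\to\infty$ for some $\delta>0$, then, almost surely, $$\lim_{m\to\infty}\left|m^{-1}R_m(t)-\mathbb E[m^{-1}R_m(t)]\right|=0,\qquad \lim_{m\to\infty}\left|m^{-1}V_m(t)-\mathbb E[m^{-1}V_m(t)]\right|=0.$$ (c) If in addition $\liminf_{m\to\infty}m_0/m>0$, then $\lim_{m\to\infty}\left|m_0^{-1}V_m(t)-\mathbb E[m_0^{-1}V_m(t)]\right|=0$ almost surely. -/

import Mathlib

open MeasureTheory ProbabilityTheory Filter Topology Asymptotics

namespace Lancaster

noncomputable section

/-! ### Orthogonal polynomials and marginal densities -/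

/-- Pochhammer symbol `(a)_n = a (a+1) ⋯ (a+n-1)`. -/
def poch (a : ℝ) (n : ℕ) : ℝ := (ascPochhammer ℝ n).eval a

/-- Generalized Laguerre polynomial
`L_n^{(a)}(x) = ∑_{k=0}^n binom(n+a, n-k) (-x)^k / k!`. -/
def laguerre (a : ℝ) (n : ℕ) (x : ℝ) : ℝ :=
  ∑ k ∈ Finset.range (n + 1), Ring.choose ((n : ℝ) + a) (n - k) * (-x) ^ k / (k.factorial : ℝ)

/-- Normalized Charlier polynomial of degree `n`. -/
def charlier (a : ℝ) (n x : ℕ) : ℝ :=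
  Real.sqrt (a ^ n / (n.factorial : ℝ)) *
    ∑ k ∈ Finset.range (n + 1),
      (-1 : ℝ) ^ k * (n.choose k : ℝ) * (x.choose k : ℝ) * ((k.factorial : ℝ) / a ^ k)

/-- Normalized Meixner polynomial of degree `n`. -/
def meixner (β c : ℝ) (n x : ℕ) : ℝ :=
  Real.sqrt (c ^ n * poch β n / (n.factorial : ℝ)) *
    ∑ k ∈ Finset.range (n + 1),
      poch (-(n : ℝ)) k * poch (-(x : ℝ)) k / (poch β k * (k.factorial : ℝ)) * (1 - c⁻¹) ^ k

/-- Gamma density with shape `α` and unit scale (used for `x > 0`). -/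
def gammaDensity (α x : ℝ) : ℝ := x ^ (α - 1) * Real.exp (-x) / Real.Gamma α

/-- Poisson probability mass function with mean `a`. -/
def poissonPmf (a : ℝ) (x : ℕ) : ℝ := a ^ x * Real.exp (-a) / (x.factorial : ℝ)

/-- Negative binomial probability mass function. -/
def negBinPmf (β c : ℝ) (x : ℕ) : ℝ := (1 - c) ^ β * (c ^ x * poch β x / (x.factorial : ℝ))

/-! ### The four joint densities -/

def gammaJoint (α ρ : ℝ) (z : ℝ × ℝ) : ℝ :=
  gammaDensity α z.1 * gammaDensity α z.2 *
    ∑' n : ℕ, ρ ^ n * ((n.factorial : ℝ) * Real.Gamma α / Real.Gamma (α + n)) *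
      laguerre (α - 1) n z.1 * laguerre (α - 1) n z.2

def poissonJoint (a ρ : ℝ) (z : ℕ × ℕ) : ℝ :=
  poissonPmf a z.1 * poissonPmf a z.2 *
    ∑' n : ℕ, ρ ^ n * charlier a n z.1 * charlier a n z.2

def negBinJoint (β c ρ : ℝ) (z : ℕ × ℕ) : ℝ :=
  negBinPmf β c z.1 * negBinPmf β c z.2 *
    ∑' n : ℕ, ρ ^ n * meixner β c n z.1 * meixner β c n z.2

/-- First coordinate negative binomial, second coordinate gamma. -/
def gammaNegBinJoint (β c α ρ : ℝ) (z : ℕ × ℝ) : ℝ :=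
  negBinPmf β c z.1 * gammaDensity α z.2 *
    ∑' n : ℕ, ρ ^ n * Real.sqrt ((n.factorial : ℝ) / poch α n) *
      laguerre (α - 1) n z.2 * meixner β c n z.1

/-- Lebesgue measure on `(0, ∞)`. -/
def lebPos : Measure ℝ := volume.restrict (Set.Ioi 0)

/-- The measure `κ` on the plane has density `h` with respect to the measure `ref`
on `E`, where `E` is placed in the plane by `emb`. -/
def HasJointDensity {E : Type*} [MeasurableSpace E] (κ : Measure (ℝ × ℝ))
    (ref : Measure E) (emb : E → ℝ × ℝ) (h : E → ℝ) : Prop :=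
  (∀ᵐ z ∂ref, 0 ≤ h z) ∧
    κ = (ref.withDensity fun z => ENNReal.ofReal (h z)).map emb

/-! ### The four Lancaster bivariate distributions -/

/-- `κ` is the Lancaster bivariate gamma law with shape `α` and correlation `ρ`. -/
def IsBivariateGamma (α ρ : ℝ) (κ : Measure (ℝ × ℝ)) : Prop :=
  0 ≤ ρ ∧ ρ < 1 ∧ HasJointDensity κ (lebPos.prod lebPos) id (gammaJoint α ρ)

/-- `κ` is the Lancaster bivariate Poisson law with parameter `a` and correlation `ρ`. -/
def IsBivariatePoisson (a ρ : ℝ) (κ : Measure (ℝ × ℝ)) : Prop :=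
  0 ≤ ρ ∧ ρ ≤ 1 ∧
    HasJointDensity κ ((Measure.count : Measure ℕ).prod (Measure.count : Measure ℕ))
      (fun z => ((z.1 : ℝ), (z.2 : ℝ))) (poissonJoint a ρ)

/-- `κ` is the Lancaster bivariate negative binomial law with parameter `(β, c)` and
correlation `ρ`. -/
def IsBivariateNegBin (β c ρ : ℝ) (κ : Measure (ℝ × ℝ)) : Prop :=
  0 ≤ ρ ∧ ρ < 1 ∧
    HasJointDensity κ ((Measure.count : Measure ℕ).prod (Measure.count : Measure ℕ))
      (fun z => ((z.1 : ℝ), (z.2 : ℝ))) (negBinJoint β c ρ)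

/-- `κ` is the Lancaster bivariate gamma-negative binomial law with parameter `(β, c, α)` and
correlation `ρ`; the first marginal is negative binomial and the second one is gamma. -/
def IsBivariateGammaNegBin (β c α ρ : ℝ) (κ : Measure (ℝ × ℝ)) : Prop :=
  0 ≤ ρ ∧ ρ ≤ Real.sqrt c ∧
    HasJointDensity κ ((Measure.count : Measure ℕ).prod lebPos)
      (fun z => ((z.1 : ℝ), z.2)) (gammaNegBinJoint β c α ρ)

/-- `κ` is one of the four Lancaster laws, with correlation `ρ` and admissible parameters. -/
def IsLancaster (ρ : ℝ) (κ : Measure (ℝ × ℝ)) : Prop :=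
  (∃ α : ℝ, 0 < α ∧ α ≤ 1 ∧ IsBivariateGamma α ρ κ) ∨
  (∃ a : ℝ, 0 < a ∧ IsBivariatePoisson a ρ κ) ∨
  (∃ β c : ℝ, 0 < β ∧ 0 < c ∧ c < 1 ∧ IsBivariateNegBin β c ρ κ) ∨
  (∃ β c α : ℝ, 0 < β ∧ 0 < c ∧ c < 1 ∧ 0 < α ∧ IsBivariateGammaNegBin β c α ρ κ)

/-! ### Multiple testing -/

/-- Pearson correlation coefficient. -/
def corr {Ω : Type*} [MeasurableSpace Ω] (P : Measure Ω) (X Y : Ω → ℝ) : ℝ :=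
  cov[X, Y; P] / (Real.sqrt Var[X; P] * Real.sqrt Var[Y; P])

/-- A sequence of test statistics `ζ i`. The statistic `ζ i` has the distribution
`law i (μ i)`, where `θ ↦ law i θ` (`θ ∈ Θ`) are its possible distributions, and the `i`-th null
hypothesis is `μ i = μ₀`. -/
structure TestingProblem {Ω : Type*} [MeasurableSpace Ω] (P : Measure Ω) where
  ζ : ℕ → Ω → ℝ
  measurable_ζ : ∀ i, Measurable (ζ i)
  Θ : Set ℝ
  μ₀ : ℝ
  μ₀_mem : μ₀ ∈ Θ
  μ : ℕ → ℝ
  μ_mem : ∀ i, μ i ∈ Θ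
  law : ℕ → ℝ → Measure ℝ
  isProbabilityMeasure_law : ∀ i, ∀ θ ∈ Θ, IsProbabilityMeasure (law i θ)
  map_ζ : ∀ i, P.map (ζ i) = law i (μ i)

namespace TestingProblem

variable {Ω : Type*} [MeasurableSpace Ω] {P : Measure Ω} (T : TestingProblem P)

/-- The correlation of `ζ i` and `ζ j`. -/
def ρ (i j : ℕ) : ℝ := corr P (T.ζ i) (T.ζ j)

/-- The entrywise `l₁`-norm of the correlation matrix of the first `m` statistics. -/
def corrNorm (m : ℕ) : ℝ := ∑ i ∈ Finset.range m, ∑ j ∈ Finset.range m, |T.ρ i j|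

/-- Every pair, taken in one of its two orders, has a Lancaster law with its own correlation.
(The order matters only for the gamma-negative binomial law.) -/
def PairwiseLancaster : Prop :=
  ∀ i j : ℕ, i ≠ j →
    IsLancaster (T.ρ i j) (P.map fun ω => (T.ζ i ω, T.ζ j ω)) ∨
    IsLancaster (T.ρ i j) (P.map fun ω => (T.ζ j ω, T.ζ i ω))

/-- One-sided p-value: one minus the null CDF evaluated at the statistic. -/
def pValue (i : ℕ) (ω : Ω) : ℝ := 1 - cdf (T.law i T.μ₀) (T.ζ i ω)

/-- The indicator of the rejection of the `i`-th null hypothesis at threshold `t`. -/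
def reject (t : ℝ) (i : ℕ) : Ω → ℝ := Set.indicator {ω | T.pValue i ω ≤ t} 1

open Classical in
/-- The indices of the true null hypotheses among the first `m`. -/
def trueNulls (m : ℕ) : Finset ℕ := (Finset.range m).filter fun i => T.μ i = T.μ₀

/-- The number of true null hypotheses among the first `m`. -/
def m₀ (m : ℕ) : ℕ := (T.trueNulls m).card

/-- The number of rejections. -/
def R (t : ℝ) (m : ℕ) (ω : Ω) : ℝ := ∑ i ∈ Finset.range m, T.reject t i ω

/-- The number of false discoveries. -/
def V (t : ℝ) (m : ℕ) (ω : Ω) : ℝ := ∑ i ∈ T.trueNulls m, T.reject t i ω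

end TestingProblem

/-- `|Y m - E[Y m]| → 0` almost surely. -/
def ConvergesToMean {Ω : Type*} [MeasurableSpace Ω] (P : Measure Ω) (Y : ℕ → Ω → ℝ) : Prop :=
  ∀ᵐ ω ∂P, Tendsto (fun m => |Y m ω - ∫ ω', Y m ω' ∂P|) atTop (𝓝 0)

end

end Lancaster

namespace Lancaster

/-! ### Alternating binomial sums -/

/-! Each of the four joint densities is a diagonal series `∑ ρ ^ n * (u n x * v n y)`, where `u n`
and `v n` are orthonormal polynomials multiplied by their marginal weights. The weights are
probability densities, so Cauchy-Schwarz bounds every `u n` and `v n` by one in `L¹`. This single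
fact (`IsL1Normalized`) replaces all pointwise estimates on the polynomials. It makes the series
integrable term by term for `ρ < 1`, and the probability of a rectangle `A ×ˢ B` becomes `∑ ρ ^ n *
(a n * b n)` with coefficients in `[-1, 1]`. The term `n = 0` is a product and the others add up to
at most `ρ / (1 - ρ)`, so every event depending on one coordinate has covariance at most `6 * ρ`
with every event depending on the other (`abs_measureReal_prod_sub_mul_le`). Neither the parameters
nor the threshold enter the constant.

The squared norms come from one algebraic scheme. Laguerre, Charlier and Meixner polynomials are all
alternating binomial sums of simple functions `ψ k` (powers or falling factorials) whose mixed
moments are explicit. The alternating sum over `k` of the moments of `ψ j * ψ k` is a multiple of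
the falling factorial of `j` of order `n`, hence zero for `j < n`; this is orthogonality, and `j =
n` gives the norm (`IsL1Normalized.of_moments`).

For the almost sure limits, the covariance bound gives the centred averages a variance of polynomial
decay. The variances are summable along `m = k ^ q` for large `q`, and boundedness of the summands
fills the gaps (`ae_tendsto_average_zero`). -/

lemma poch_zero (a : ℝ) : poch a 0 = 1 := by simp [poch]

lemma poch_succ (a : ℝ) (n : ℕ) : poch a (n + 1) = poch a n * (a + n) := by
  simp [poch, ascPochhammer_succ_eval]

lemma poch_succ_left (a : ℝ) (n : ℕ) : poch a (n + 1) = a * poch (a + 1) n := by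
  simp [poch, ascPochhammer_succ_left]

lemma poch_pos {a : ℝ} (ha : 0 < a) (n : ℕ) : 0 < poch a n := ascPochhammer_pos n a ha

lemma poch_add (a : ℝ) (j k : ℕ) : poch a (j + k) = poch a j * poch (a + j) k := by
  induction k with
  | zero => simp [poch_zero]
  | succ k ih => rw [← add_assoc, poch_succ, poch_succ, ih]; push_cast; ring

lemma poch_neg_natCast (j n : ℕ) : poch (-(j : ℝ)) n = (-1) ^ n * (j.descFactorial n : ℝ) := by
  rw [poch, ascPochhammer_eval_neg_eq_descPochhammer, descPochhammer_eval_eq_descFactorial]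

/-- The alternating binomial sum `∑ (-1)^k binom(n,k) f k`. -/
noncomputable def altSum (n : ℕ) (f : ℕ → ℝ) : ℝ :=
  ∑ k ∈ Finset.range (n + 1), (-1 : ℝ) ^ k * (n.choose k : ℝ) * f k

lemma altSum_zero (f : ℕ → ℝ) : altSum 0 f = f 0 := by simp [altSum]

lemma altSum_congr (n : ℕ) {f g : ℕ → ℝ} (h : ∀ k ≤ n, f k = g k) : altSum n f = altSum n g :=
  Finset.sum_congr rfl fun k hk => by rw [h k (by simpa [Nat.lt_succ_iff] using hk)]

lemma altSum_mul_left (n : ℕ) (c : ℝ) (f : ℕ → ℝ) :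
    altSum n (fun k => c * f k) = c * altSum n f := by
  simp only [altSum, Finset.mul_sum]
  exact Finset.sum_congr rfl fun k _ => by ring

lemma altSum_sum (n m : ℕ) (f : ℕ → ℕ → ℝ) :
    altSum n (fun k => ∑ i ∈ Finset.range m, f i k) = ∑ i ∈ Finset.range m, altSum n (f i) := by
  simp only [altSum, Finset.mul_sum]
  exact Finset.sum_comm

/-- Pascal's rule: `altSum n` is the `n`-th iterated difference at zero, up to sign. -/
lemma altSum_succ (n : ℕ) (f : ℕ → ℝ) :
    altSum (n + 1) f = altSum n (fun k => f k - f (k + 1)) := by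
  have h1 : altSum n f = f 0 + ∑ k ∈ Finset.range (n + 1),
      (-1 : ℝ) ^ (k + 1) * (n.choose (k + 1) : ℝ) * f (k + 1) := by
    rw [Finset.sum_range_succ, altSum, Finset.sum_range_succ']
    simp [add_comm]
  have h2 : altSum n (fun k => f k - f (k + 1)) = altSum n f - altSum n (fun k => f (k + 1)) := by
    simp only [altSum, ← Finset.sum_sub_distrib, mul_sub]
  rw [h2, h1, altSum, altSum, Finset.sum_range_succ', add_comm, add_sub_assoc,
    ← Finset.sum_sub_distrib]
  congr 1
  · simp
  · refine Finset.sum_congr rfl fun k _ => ?_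
    rw [Nat.choose_succ_succ']
    push_cast
    ring

lemma altSum_one (n : ℕ) : altSum n (fun _ => 1) = if n = 0 then 1 else 0 := by
  cases n with
  | zero => simp [altSum_zero]
  | succ n => rw [altSum_succ]; simp [altSum]

/-- The Chu-Vandermonde identity. -/
lemma altSum_poch_div_poch (n : ℕ) {a : ℝ} (ha : 0 < a) (b : ℝ) :
    altSum n (fun k => poch b k / poch a k) = poch (a - b) n / poch a n := by
  induction n generalizing a with
  | zero => simp [altSum_zero, poch_zero]
  | succ n ih =>
    -- The difference of consecutive ratios is a ratio of the same form with `a` replaced by `a +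
    -- 1`; hence the induction runs over all `a`.
    have h : ∀ k, poch b k / poch a k - poch b (k + 1) / poch a (k + 1) =
        (a - b) / a * (poch b k / poch (a + 1) k) := fun k => by
      have h1 := poch_pos ha k
      have h2 := poch_pos (show 0 < a + 1 by linarith) k
      have h3 : poch a k * (a + k) = a * poch (a + 1) k := by rw [← poch_succ, poch_succ_left]
      have h4 : poch (a + 1) k = poch a k * (a + k) / a := by field_simp; linarith
      have h5 : 0 < a + k := by positivity
      rw [poch_succ, poch_succ, h4]
      field_simp
      ring
    rw [altSum_succ]
    simp only [h]
    rw [altSum_mul_left, ih (by linarith), poch_succ_left, poch_succ_left a,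
      show a + 1 - b = a - b + 1 by ring, div_mul_div_comm]

/-- Terms with `k < i` vanish, and in the others `binom(n,k) binom(k,i) = binom(n,i)
binom(n-i,k-i)`. -/
lemma altSum_choose_mul (n i : ℕ) (hi : i ≤ n) (f : ℕ → ℝ) :
    altSum n (fun k => (k.choose i : ℝ) * f k) =
      (-1) ^ i * (n.choose i : ℝ) * altSum (n - i) (fun l => f (i + l)) := by
  rw [altSum, show n + 1 = i + (n - i + 1) by omega, Finset.sum_range_add,
    Finset.sum_eq_zero, zero_add, altSum, Finset.mul_sum]
  · refine Finset.sum_congr rfl fun l hl => ?_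
    have hl' : l ≤ n - i := by simpa [Nat.lt_succ_iff] using hl
    have h : ((n.choose (i + l) : ℝ)) * ((i + l).choose i : ℝ) =
        (n.choose i : ℝ) * ((n - i).choose l : ℝ) := by
      have := Nat.choose_mul (n := n) (k := i + l) (s := i) (by omega)
      rw [Nat.add_sub_cancel_left] at this
      exact_mod_cast this
    rw [pow_add]
    linear_combination (-1) ^ i * (-1) ^ l * f (i + l) * h
  · intro k hk
    have : k.choose i = 0 := Nat.choose_eq_zero_of_lt (by simpa using hk)
    simp [this]

/-- Vandermonde's convolution, multiplied by `k!`. -/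
lemma add_descFactorial (x j k : ℕ) :
    ((x + j).descFactorial k : ℝ) = ∑ i ∈ Finset.range (k + 1),
      (k.choose i : ℝ) * (j.descFactorial i : ℝ) * (x.descFactorial (k - i) : ℝ) := by
  rw [Nat.descFactorial_eq_factorial_mul_choose, add_comm x j, Nat.add_choose_eq,
    Finset.Nat.sum_antidiagonal_eq_sum_range_succ (fun p q => j.choose p * x.choose q)]
  push_cast
  rw [Finset.mul_sum]
  refine Finset.sum_congr rfl fun i hi => ?_
  have hi' : i ≤ k := by simpa [Nat.lt_succ_iff] using hi
  rw [Nat.descFactorial_eq_factorial_mul_choose, Nat.descFactorial_eq_factorial_mul_choose,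
    ← Nat.choose_mul_factorial_mul_factorial hi']
  push_cast
  ring

/-- Orthogonality of the Charlier polynomials. After exchanging the sums, the alternating sum of
`binom(k,i)` vanishes unless `i = n`. -/
lemma altSum_choose_mul_descFactorial (n j : ℕ) (b : ℝ) :
    altSum n (fun k => ∑ i ∈ Finset.range (k + 1),
      (k.choose i : ℝ) * (j.descFactorial i : ℝ) * b ^ i) =
      (-1) ^ n * (j.descFactorial n : ℝ) * b ^ n := by
  have h : ∀ k ≤ n, ∑ i ∈ Finset.range (k + 1),
      (k.choose i : ℝ) * (j.descFactorial i : ℝ) * b ^ i =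
      ∑ i ∈ Finset.range (n + 1), (k.choose i : ℝ) * ((j.descFactorial i : ℝ) * b ^ i) := by
    intro k hk
    simp only [mul_assoc]
    refine Finset.sum_subset (by simpa using hk) fun i _ hi => ?_
    rw [Nat.choose_eq_zero_of_lt (by simpa using hi)]
    simp
  rw [altSum_congr n h, altSum_sum, Finset.sum_eq_single n]
  · rw [altSum_choose_mul n n le_rfl]
    simp [altSum_zero, mul_assoc]
  · intro i hi hin
    have hi' : i < n := by simp at hi; omega
    rw [altSum_choose_mul n i hi'.le]
    have := altSum_mul_left (n - i) ((j.descFactorial i : ℝ) * b ^ i) (fun _ => 1)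
    simp only [mul_one] at this
    rw [this, altSum_one, if_neg (by omega)]
    simp
  · simp

lemma descFactorial_mul_poch_sub (i j n : ℕ) (hi : i ≤ n) :
    (j.descFactorial i : ℝ) * poch ((i : ℝ) - j) (n - i) =
      (-1) ^ (n - i) * (j.descFactorial n : ℝ) := by
  rcases le_or_gt i j with hij | hij
  · rw [show (i : ℝ) - j = -((j - i : ℕ) : ℝ) by push_cast [hij]; ring, poch_neg_natCast]
    have : (j - i).descFactorial (n - i) * j.descFactorial i = j.descFactorial n :=
      Nat.descFactorial_mul_descFactorial hi
    rw [← this]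
    push_cast
    ring
  · rw [Nat.descFactorial_eq_zero_iff_lt.2 hij, Nat.descFactorial_eq_zero_iff_lt.2 (by omega)]
    simp

/-- Orthogonality of the Meixner polynomials. For fixed `i` the sum over `k` is a Chu-Vandermonde
sum equal to a multiple of `poch (i - j) (n - i)`, which completes the falling factorial of `j` to
order `n`. The remaining sum over `i` is the binomial expansion of `(1 + b) ^ n`. -/
lemma altSum_choose_mul_descFactorial_mul_poch (n j : ℕ) {β : ℝ} (hβ : 0 < β) (b : ℝ) :
    altSum n (fun k => (∑ i ∈ Finset.range (k + 1),
      (k.choose i : ℝ) * (j.descFactorial i : ℝ) * (poch (β + j) (k - i) * b ^ i)) / poch β k) =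
      (-1) ^ n * (j.descFactorial n : ℝ) * ((1 + b) ^ n / poch β n) := by
  have h : ∀ k ≤ n, (∑ i ∈ Finset.range (k + 1),
      (k.choose i : ℝ) * (j.descFactorial i : ℝ) * (poch (β + j) (k - i) * b ^ i)) / poch β k =
      ∑ i ∈ Finset.range (n + 1), (k.choose i : ℝ) *
        ((j.descFactorial i : ℝ) * (poch (β + j) (k - i) * b ^ i) / poch β k) := by
    intro k hk
    rw [Finset.sum_div]
    simp only [mul_assoc, mul_div_assoc]
    refine Finset.sum_subset (by simpa using hk) fun i _ hi => ?_
    rw [Nat.choose_eq_zero_of_lt (by simpa using hi)]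
    simp
  rw [altSum_congr n h, altSum_sum, add_comm 1 b, add_pow, Finset.sum_div, Finset.mul_sum]
  refine Finset.sum_congr rfl fun i hi => ?_
  have hi' : i ≤ n := by simpa [Nat.lt_succ_iff] using hi
  rw [altSum_choose_mul n i hi']
  have h2 : ∀ l, (j.descFactorial i : ℝ) * (poch (β + j) (i + l - i) * b ^ i) / poch β (i + l) =
      (j.descFactorial i : ℝ) * b ^ i / poch β i * (poch (β + j) l / poch (β + i) l) := by
    intro l
    rw [poch_add, Nat.add_sub_cancel_left, div_mul_div_comm]
    ring
  simp only [h2]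
  have hp := poch_pos (show 0 < β + i by positivity) (n - i)
  have hp' := poch_pos hβ i
  rw [altSum_mul_left, altSum_poch_div_poch _ (by positivity),
    show β + i - (β + j) = (i : ℝ) - j by ring]
  have h3 := descFactorial_mul_poch_sub i j n hi'
  have h4 : poch β n = poch β i * poch (β + i) (n - i) := by rw [← poch_add]; congr; omega
  have h5 : (-1 : ℝ) ^ n = (-1) ^ i * (-1) ^ (n - i) := by rw [← pow_add]; congr; omega
  rw [h4, h5]
  field_simp
  linear_combination (n.choose i : ℝ) * b ^ i * h3

/-! ### Weighted orthonormal polynomials -/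

/-- The functions `u n` have `L¹`-norm at most one, and `u 0` has integral one. -/
structure IsL1Normalized {E : Type*} [MeasurableSpace E] (ν : Measure E) (u : ℕ → E → ℝ) :
    Prop where
  integrable : ∀ n, Integrable (u n) ν
  integral_abs_le : ∀ n, ∫ x, |u n x| ∂ν ≤ 1
  integral_zero : ∫ x, u 0 x ∂ν = 1

section Orthonormal

variable {E : Type*} [MeasurableSpace E] {ν : Measure E} {w : E → ℝ} {ψ : ℕ → E → ℝ}

lemma integrable_mul_altSum (n : ℕ) (hInt : ∀ k, Integrable (fun x => w x * ψ k x) ν) :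
    Integrable (fun x => w x * altSum n (fun k => ψ k x)) ν := by
  have : (fun x => w x * altSum n (fun k => ψ k x)) = fun x => ∑ k ∈ Finset.range (n + 1),
      ((-1 : ℝ) ^ k * (n.choose k : ℝ)) * (w x * ψ k x) := by
    ext x
    rw [altSum, Finset.mul_sum]
    exact Finset.sum_congr rfl fun k _ => by ring
  rw [this]
  exact integrable_finsetSum _ fun k _ => (hInt k).const_mul _

lemma integral_mul_altSum (n : ℕ) (hInt : ∀ k, Integrable (fun x => w x * ψ k x) ν) :
    ∫ x, w x * altSum n (fun k => ψ k x) ∂ν = altSum n (fun k => ∫ x, w x * ψ k x ∂ν) := by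
  have : (fun x => w x * altSum n (fun k => ψ k x)) = fun x => ∑ k ∈ Finset.range (n + 1),
      ((-1 : ℝ) ^ k * (n.choose k : ℝ)) * (w x * ψ k x) := by
    ext x
    rw [altSum, Finset.mul_sum]
    exact Finset.sum_congr rfl fun k _ => by ring
  rw [this, integral_finsetSum _ fun k _ => (hInt k).const_mul _]
  simp only [integral_const_mul, altSum]

/-- Falling factorials of order `n` vanish at `j < n`, so only the top term survives; it is the
squared norm of the `n`-th polynomial. -/
lemma altSum_descFactorial (n : ℕ) (c : ℝ) :
    altSum n (fun j => (-1) ^ n * (j.descFactorial n : ℝ) * c) = n.factorial * c := by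
  rw [altSum, Finset.sum_eq_single n]
  · rw [Nat.descFactorial_self, Nat.choose_self]
    have : (-1 : ℝ) ^ n * (-1) ^ n = 1 := by rw [← mul_pow]; simp
    push_cast
    linear_combination (n.factorial : ℝ) * c * this
  · intro j hj hjn
    rw [Nat.descFactorial_eq_zero_iff_lt.2 (by simp at hj; omega)]
    simp
  · simp

/-- If the mixed moments `∫ w ψ_j ψ_k` have the alternating sums of an orthogonal system with
squared norms `n! h_n`, then the weighted normalized combinations are bounded in `L¹`. -/
theorem IsL1Normalized.of_moments {h s : ℕ → ℝ} (hw : ∀ᵐ x ∂ν, 0 ≤ w x)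
    (hψ : ∀ x, ψ 0 x = 1) (hInt : ∀ j k, Integrable (fun x => w x * (ψ j x * ψ k x)) ν)
    (hs : ∀ n, s n ^ 2 * (n.factorial * h n) = 1) (hs0 : s 0 = 1)
    (horth : ∀ n j, altSum n (fun k => ∫ x, w x * (ψ j x * ψ k x) ∂ν) =
      (-1) ^ n * (j.descFactorial n : ℝ) * h n) :
    IsL1Normalized ν (fun n x => w x * (s n * altSum n (fun k => ψ k x))) := by
  have hone : ∀ k, Integrable (fun x => w x * ψ k x) ν := fun k => by
    simpa [hψ] using hInt 0 k
  have hInt' : ∀ j k, Integrable (fun x => (w x * ψ j x) * ψ k x) ν := fun j k => by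
    simpa only [mul_assoc] using hInt j k
  have hinner : ∀ n j, Integrable (fun x => w x * ψ j x * altSum n (fun k => ψ k x)) ν :=
    fun n j => integrable_mul_altSum n (hInt' j)
  have hinner' : ∀ n j, Integrable (fun x => (w x * altSum n (fun k => ψ k x)) * ψ j x) ν :=
    fun n j => (hinner n j).congr (.of_forall fun x => by ring)
  have hnorm_int : ∀ n, Integrable (fun x => w x * (altSum n (fun k => ψ k x)) ^ 2) ν := fun n =>
    (integrable_mul_altSum n (hinner' n)).congr (.of_forall fun x => by ring)
  have hnorm : ∀ n, ∫ x, w x * (altSum n (fun k => ψ k x)) ^ 2 ∂ν = n.factorial * h n := by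
    intro n
    -- Only one factor of the square is expanded; the other is kept whole and paired with each `ψ
    -- j`.
    calc ∫ x, w x * (altSum n (fun k => ψ k x)) ^ 2 ∂ν
        = ∫ x, (w x * altSum n (fun k => ψ k x)) * altSum n (fun k => ψ k x) ∂ν := by
          congr 1; ext x; ring
      _ = altSum n (fun j => ∫ x, (w x * ψ j x) * altSum n (fun k => ψ k x) ∂ν) := by
          rw [integral_mul_altSum n (hinner' n)]
          congr 1; ext j; congr 1; ext x; ring
      _ = altSum n (fun j => (-1) ^ n * (j.descFactorial n : ℝ) * h n) := by
          congr 1; ext j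
          rw [integral_mul_altSum n (hInt' j), ← horth n j]
          simp only [mul_assoc]
      _ = n.factorial * h n := altSum_descFactorial n _
  have hw_int : Integrable w ν := by simpa [hψ] using hInt 0 0
  have hw_one : ∫ x, w x ∂ν = 1 := by
    have h1 := horth 0 0
    have h2 := hs 0
    simp only [altSum_zero, hψ] at h1
    simp [hs0] at h1 h2
    rw [h1, h2]
  have hu_int : ∀ n, Integrable (fun x => w x * (s n * altSum n (fun k => ψ k x))) ν := fun n =>
    ((integrable_mul_altSum n hone).const_mul (s n)).congr (.of_forall fun x => by ring)
  refine ⟨hu_int, fun n => ?_, by simpa [altSum_zero, hψ, hs0] using hw_one⟩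
  have hb := ((hnorm_int n).const_mul (s n ^ 2))
  calc ∫ x, |w x * (s n * altSum n (fun k => ψ k x))| ∂ν
      ≤ ∫ x, (2⁻¹ * (w x + s n ^ 2 * (w x * (altSum n (fun k => ψ k x)) ^ 2))) ∂ν := by
        refine integral_mono_ae (hu_int n).abs ((hw_int.add hb).const_mul 2⁻¹) ?_
        filter_upwards [hw] with x hx
        set y := s n * altSum n (fun k => ψ k x) with hy
        -- This pointwise inequality stands in for Cauchy-Schwarz: integrated against `w` it bounds
        -- the `L¹`-norm by `(1 + 1) / 2`.
        have h1 : 2 * |y| ≤ 1 + y ^ 2 := by nlinarith [sq_nonneg (1 - |y|), sq_abs y]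
        have h2 : s n ^ 2 * (w x * (altSum n (fun k => ψ k x)) ^ 2) = w x * y ^ 2 := by
          rw [hy]; ring
        simp only [h2]
        rw [abs_mul, abs_of_nonneg hx]
        nlinarith
    _ = 1 := by
        rw [integral_const_mul, integral_add hw_int hb, integral_const_mul, hnorm, hs, hw_one]
        norm_num

end Orthonormal

/-! ### The gamma weight -/

lemma Gamma_add_natCast {α : ℝ} (hα : 0 < α) (n : ℕ) :
    Real.Gamma (α + n) = poch α n * Real.Gamma α := by
  induction n with
  | zero => simp [poch_zero]
  | succ n ih =>
    push_cast
    rw [← add_assoc, Real.Gamma_add_one (by positivity), ih, poch_succ]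
    ring

lemma gammaDensity_mul_pow {α : ℝ} (k : ℕ) {x : ℝ} (hx : 0 < x) :
    gammaDensity α x * x ^ k = (Real.Gamma α)⁻¹ * (Real.exp (-x) * x ^ (α + k - 1)) := by
  rw [gammaDensity, show α + k - 1 = α - 1 + k by ring, Real.rpow_add_natCast hx.ne']
  ring

lemma integrable_gammaDensity_mul_pow {α : ℝ} (hα : 0 < α) (k : ℕ) :
    Integrable (fun x => gammaDensity α x * x ^ k) lebPos := by
  have h := (Real.GammaIntegral_convergent (show 0 < α + k by positivity)).const_mul
    (Real.Gamma α)⁻¹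
  exact IntegrableOn.congr_fun h (fun x hx => (gammaDensity_mul_pow k hx).symm) measurableSet_Ioi

lemma integral_gammaDensity_mul_pow {α : ℝ} (hα : 0 < α) (k : ℕ) :
    ∫ x, gammaDensity α x * x ^ k ∂lebPos = poch α k := by
  rw [lebPos, setIntegral_congr_fun measurableSet_Ioi
    (fun x hx => gammaDensity_mul_pow (α := α) k hx), integral_const_mul,
    ← Real.Gamma_eq_integral (by positivity), Gamma_add_natCast hα]
  have := (Real.Gamma_pos_of_pos hα).ne'
  field_simp

lemma laguerre_eq {α : ℝ} (hα : 0 < α) (n : ℕ) (x : ℝ) :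
    laguerre (α - 1) n x =
      poch α n / n.factorial * altSum n (fun k => x ^ k / poch α k) := by
  rw [laguerre, altSum, Finset.mul_sum]
  refine Finset.sum_congr rfl fun k hk => ?_
  have hk' : k ≤ n := by simpa [Nat.lt_succ_iff] using hk
  have h1 : Ring.choose ((n : ℝ) + (α - 1)) (n - k) =
      poch (α + k) (n - k) / (n - k).factorial := by
    rw [Ring.choose_eq_smul, Polynomial.descPochhammer_smeval_eq_ascPochhammer,
      Polynomial.ascPochhammer_smeval_cast, Polynomial.ascPochhammer_smeval_eq_eval, poch,
      smul_eq_mul, show (n : ℝ) + (α - 1) - (n - k : ℕ) + 1 = α + k by push_cast [hk']; ring]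
    ring
  have h2 : poch α n = poch α k * poch (α + k) (n - k) := by rw [← poch_add]; congr; omega
  have h3 : (n.factorial : ℝ) = n.choose k * k.factorial * (n - k).factorial := by
    exact_mod_cast (Nat.choose_mul_factorial_mul_factorial hk').symm
  have h4 := (poch_pos hα k).ne'
  have h5 : (n.choose k : ℝ) ≠ 0 := by exact_mod_cast (Nat.choose_pos hk').ne'
  have h6 : (k.factorial : ℝ) ≠ 0 := by positivity
  have h7 : ((n - k).factorial : ℝ) ≠ 0 := by positivity
  rw [h1, h2, h3, neg_pow]
  field_simp

/-- The weighted orthonormal Laguerre polynomials. -/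
lemma isL1Normalized_laguerre {α : ℝ} (hα : 0 < α) :
    IsL1Normalized lebPos (fun n x => gammaDensity α x *
      (Real.sqrt (n.factorial / poch α n) * laguerre (α - 1) n x)) := by
  have hmul : ∀ j k x, gammaDensity α x * (x ^ j / poch α j * (x ^ k / poch α k)) =
      (poch α j * poch α k)⁻¹ * (gammaDensity α x * x ^ (j + k)) := fun j k x => by
    have h1 := (poch_pos hα j).ne'
    have h2 := (poch_pos hα k).ne'
    field_simp
    ring
  have key : IsL1Normalized lebPos (fun n x => gammaDensity α x *
      (Real.sqrt (poch α n / n.factorial) * altSum n (fun k => x ^ k / poch α k))) := by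
    refine IsL1Normalized.of_moments (ψ := fun k x => x ^ k / poch α k)
      (h := fun n => (poch α n)⁻¹) (s := fun n => Real.sqrt (poch α n / n.factorial)) ?_
      (by simp [poch_zero]) ?_ ?_ (by simp [poch_zero]) ?_
    · refine (ae_restrict_iff' measurableSet_Ioi).2 (.of_forall fun x (hx : 0 < x) => ?_)
      have := Real.Gamma_pos_of_pos hα
      unfold gammaDensity
      positivity
    · intro j k
      simp only [hmul]
      exact (integrable_gammaDensity_mul_pow hα (j + k)).const_mul _
    · intro n
      have h1 := poch_pos hα n
      rw [Real.sq_sqrt (by positivity)]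
      field_simp
    · intro n j
      -- The moments turn the orthogonality relation into Chu-Vandermonde with `b = α + j`, whose
      -- value involves `poch (-j) n`.
      have h1 : ∀ k, ∫ x, gammaDensity α x * (x ^ j / poch α j * (x ^ k / poch α k)) ∂lebPos =
          poch (α + j) k / poch α k := fun k => by
        simp only [hmul]
        rw [integral_const_mul, integral_gammaDensity_mul_pow hα, poch_add]
        have h1 := (poch_pos hα j).ne'
        have h2 := (poch_pos hα k).ne'
        field_simp
      simp only [h1]
      rw [altSum_poch_div_poch n hα, show α - (α + j) = -(j : ℝ) by ring, poch_neg_natCast]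
      ring
  convert key using 4 with n x
  have h1 := poch_pos hα n
  have h2 : Real.sqrt (poch α n / n.factorial) =
      Real.sqrt (n.factorial / poch α n) * (poch α n / n.factorial) := by
    rw [eq_comm, ← Real.sqrt_sq (show 0 ≤ poch α n / n.factorial by positivity),
      ← Real.sqrt_mul (by positivity), Real.sqrt_sq (by positivity)]
    congr 1
    field_simp
  rw [laguerre_eq hα, h2]
  ring

/-! ### Discrete weights -/

lemma integrable_count_of_hasSum {f : ℕ → ℝ} {a : ℝ} (hf : ∀ n, 0 ≤ f n) (h : HasSum f a) :
    Integrable f Measure.count := by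
  rw [integrable_count_iff]
  simpa [abs_of_nonneg (hf _)] using h.summable

lemma integral_count_of_hasSum {f : ℕ → ℝ} {a : ℝ} (hf : ∀ n, 0 ≤ f n) (h : HasSum f a) :
    ∫ n, f n ∂Measure.count = a := by
  rw [integral_countable (integrable_count_of_hasSum hf h)]
  simpa [measureReal_def] using h.tsum_eq

/-- The falling factorial vanishes for `x < j`, so the sum may start at `j`. -/
lemma hasSum_mul_descFactorial_of_shift {f g : ℕ → ℝ} {a : ℝ} (j : ℕ)
    (hfg : ∀ x, f (x + j) * ((x + j).descFactorial j : ℝ) = g x) (h : HasSum g a) :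
    HasSum (fun x => f x * (x.descFactorial j : ℝ)) a := by
  rw [← Function.Injective.hasSum_iff (add_left_injective j)]
  · exact h.congr_fun fun x => hfg x
  · intro x hx
    rw [Nat.descFactorial_eq_zero_iff_lt.2]
    · simp
    · by_contra! hjx
      exact hx ⟨x - j, Nat.sub_add_cancel hjx⟩

lemma factorial_mul_descFactorial_add (x j : ℕ) :
    ((x + j).descFactorial j : ℝ) / (x + j).factorial = 1 / x.factorial := by
  have h := Nat.factorial_mul_descFactorial (show j ≤ x + j by omega)
  rw [Nat.add_sub_cancel] at h
  have h' : (x.factorial : ℝ) * (x + j).descFactorial j = (x + j).factorial := by exact_mod_cast h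
  have := Nat.factorial_ne_zero (x + j)
  field_simp
  linarith

/-! ### The Poisson weight -/

lemma poissonPmf_nonneg {a : ℝ} (ha : 0 < a) (x : ℕ) : 0 ≤ poissonPmf a x := by
  unfold poissonPmf; positivity

lemma poissonPmf_shift (a : ℝ) (x j : ℕ) :
    poissonPmf a (x + j) * ((x + j).descFactorial j : ℝ) = a ^ j * poissonPmf a x := by
  unfold poissonPmf
  linear_combination a ^ (x + j) * Real.exp (-a) * factorial_mul_descFactorial_add x j

lemma hasSum_poissonPmf (a : ℝ) : HasSum (poissonPmf a) 1 := by
  have h := (NormedSpace.expSeries_div_hasSum_exp (𝔸 := ℝ) a).mul_right (Real.exp (-a))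
  rw [← Real.exp_eq_exp_ℝ, ← Real.exp_add, add_neg_cancel, Real.exp_zero] at h
  exact h.congr_fun fun x => by unfold poissonPmf; ring

lemma hasSum_poissonPmf_mul_descFactorial (a : ℝ) (j : ℕ) :
    HasSum (fun x => poissonPmf a x * (x.descFactorial j : ℝ)) (a ^ j) :=
  hasSum_mul_descFactorial_of_shift j (poissonPmf_shift a · j) <| by
    simpa using (hasSum_poissonPmf a).mul_left (a ^ j)

/-- The factor of order `j` is absorbed by shifting the Poisson weight; the other, now evaluated at
`x + j`, is expanded by Vandermonde into ordinary factorial moments. -/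
lemma hasSum_poissonPmf_mul_descFactorial_mul (a : ℝ) (j k : ℕ) :
    HasSum (fun x => poissonPmf a x * ((x.descFactorial k : ℝ) * (x.descFactorial j : ℝ)))
      (a ^ j * ∑ i ∈ Finset.range (k + 1),
        (k.choose i : ℝ) * (j.descFactorial i : ℝ) * a ^ (k - i)) := by
  simp only [← mul_assoc]
  refine hasSum_mul_descFactorial_of_shift (f := fun x => poissonPmf a x * x.descFactorial k)
    (g := fun x => a ^ j * ∑ i ∈ Finset.range (k + 1),
      (k.choose i : ℝ) * (j.descFactorial i : ℝ) *
        (poissonPmf a x * (x.descFactorial (k - i) : ℝ))) j (fun x => ?_) ?_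
  · rw [mul_right_comm, poissonPmf_shift, add_descFactorial, mul_assoc, Finset.mul_sum]
    congr 1
    exact Finset.sum_congr rfl fun i _ => by ring
  · exact (hasSum_sum fun i _ =>
      (hasSum_poissonPmf_mul_descFactorial a (k - i)).mul_left _).mul_left _

lemma charlier_eq (a : ℝ) (n x : ℕ) :
    charlier a n x = Real.sqrt (a ^ n / n.factorial) *
      altSum n (fun k => (x.descFactorial k : ℝ) / a ^ k) := by
  rw [charlier, altSum]
  congr 1
  refine Finset.sum_congr rfl fun k _ => ?_
  rw [Nat.descFactorial_eq_factorial_mul_choose]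
  push_cast
  ring

/-- The weighted orthonormal Charlier polynomials. -/
lemma isL1Normalized_charlier {a : ℝ} (ha : 0 < a) :
    IsL1Normalized Measure.count (fun n x => poissonPmf a x * charlier a n x) := by
  simp only [charlier_eq]
  have hsum : ∀ j k, HasSum (fun x => poissonPmf a x *
      ((x.descFactorial j : ℝ) / a ^ j * ((x.descFactorial k : ℝ) / a ^ k)))
      (∑ i ∈ Finset.range (k + 1), (k.choose i : ℝ) * (j.descFactorial i : ℝ) * a⁻¹ ^ i) :=
      fun j k => by
    have h := (hasSum_poissonPmf_mul_descFactorial_mul a j k).mul_left (a ^ j * a ^ k)⁻¹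
    rw [Finset.mul_sum, Finset.mul_sum] at h
    convert h.congr_fun (g := fun x => poissonPmf a x *
      ((x.descFactorial j : ℝ) / a ^ j * ((x.descFactorial k : ℝ) / a ^ k)))
      (fun x => by field_simp) using 1
    · rfl
    refine Finset.sum_congr rfl fun i hi => ?_
    have hi' : i ≤ k := by simpa [Nat.lt_succ_iff] using hi
    have : a ^ k = a ^ (k - i) * a ^ i := by rw [← pow_add]; congr; omega
    rw [this, inv_pow]
    field_simp
  have hnn : ∀ j k x, 0 ≤ poissonPmf a x *
      ((x.descFactorial j : ℝ) / a ^ j * ((x.descFactorial k : ℝ) / a ^ k)) := fun j k x => by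
    have := poissonPmf_nonneg ha x
    positivity
  refine IsL1Normalized.of_moments (ψ := fun k x => (x.descFactorial k : ℝ) / a ^ k)
    (h := fun n => a⁻¹ ^ n) (s := fun n => Real.sqrt (a ^ n / n.factorial))
    (.of_forall (poissonPmf_nonneg ha)) (by simp) ?_ ?_ (by simp) ?_
  · exact fun j k => integrable_count_of_hasSum (hnn j k) (hsum j k)
  · intro n
    rw [Real.sq_sqrt (by positivity), inv_pow]
    field_simp
  · intro n j
    simp only [fun k => integral_count_of_hasSum (hnn j k) (hsum j k)]
    exact altSum_choose_mul_descFactorial n j a⁻¹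

/-! ### The negative binomial weight -/

lemma negBinPmf_nonneg {β c : ℝ} (hβ : 0 < β) (hc : 0 < c) (hc1 : c < 1) (x : ℕ) :
    0 ≤ negBinPmf β c x := by
  have := poch_pos hβ x
  have : 0 < 1 - c := by linarith
  unfold negBinPmf; positivity

/-- Unlike in the Poisson case, absorbing a falling factorial changes the weight: the shape `β`
rises to `β + j`. -/
lemma negBinPmf_shift {β c : ℝ} (hc1 : c < 1) (x j : ℕ) :
    negBinPmf β c (x + j) * ((x + j).descFactorial j : ℝ) =
      poch β j * (c / (1 - c)) ^ j * negBinPmf (β + j) c x := by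
  have h1 : 0 < 1 - c := by linarith
  unfold negBinPmf
  rw [Real.rpow_add_natCast h1.ne', add_comm x j, poch_add, add_comm j x, pow_add, div_pow]
  have h := factorial_mul_descFactorial_add x j
  have h3 : (c ^ j / (1 - c) ^ j) * (1 - c) ^ j = c ^ j := by field_simp
  linear_combination (1 - c) ^ β * (c ^ x * c ^ j) * (poch β j * poch (β + j) x) * h -
    poch β j * (1 - c) ^ β * c ^ x * poch (β + j) x / x.factorial * h3

/-- Newton's binomial series for `(1 - c) ^ (-β)`. -/
lemma hasSum_negBinPmf {β c : ℝ} (hc : 0 < c) (hc1 : c < 1) :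
    HasSum (negBinPmf β c) 1 := by
  have h1 : 0 < 1 - c := by linarith
  have h := (Real.one_div_one_sub_rpow_hasFPowerSeriesOnBall_zero β).hasSum (y := c)
    (by simpa [enorm_eq_nnnorm, ← NNReal.coe_lt_coe, abs_of_pos hc] using hc1)
  have h2 := h.mul_left ((1 - c) ^ β)
  rw [zero_add, mul_one_div_cancel (by positivity)] at h2
  refine h2.congr_fun fun n => ?_
  rw [negBinPmf, FormalMultilinearSeries.ofScalars_apply_eq, Ring.choose_eq_smul,
    Polynomial.descPochhammer_smeval_eq_ascPochhammer,
    Polynomial.ascPochhammer_smeval_cast, Polynomial.ascPochhammer_smeval_eq_eval, poch,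
    show β + n - 1 - n + 1 = β by ring]
  simp only [smul_eq_mul]
  ring

lemma hasSum_negBinPmf_mul_descFactorial {β c : ℝ} (hc : 0 < c) (hc1 : c < 1) (j : ℕ) :
    HasSum (fun x => negBinPmf β c x * (x.descFactorial j : ℝ))
      (poch β j * (c / (1 - c)) ^ j) :=
  hasSum_mul_descFactorial_of_shift j (negBinPmf_shift hc1 · j) <| by
    simpa using (hasSum_negBinPmf (β := β + j) hc hc1).mul_left (poch β j * (c / (1 - c)) ^ j)

lemma hasSum_negBinPmf_mul_descFactorial_mul {β c : ℝ} (hc : 0 < c) (hc1 : c < 1) (j k : ℕ) :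
    HasSum (fun x => negBinPmf β c x * ((x.descFactorial k : ℝ) * (x.descFactorial j : ℝ)))
      (poch β j * (c / (1 - c)) ^ j * ∑ i ∈ Finset.range (k + 1),
        (k.choose i : ℝ) * (j.descFactorial i : ℝ) *
          (poch (β + j) (k - i) * (c / (1 - c)) ^ (k - i))) := by
  simp only [← mul_assoc (negBinPmf β c _)]
  refine hasSum_mul_descFactorial_of_shift (f := fun x => negBinPmf β c x * x.descFactorial k)
    (g := fun x => poch β j * (c / (1 - c)) ^ j * ∑ i ∈ Finset.range (k + 1),
      (k.choose i : ℝ) * (j.descFactorial i : ℝ) *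
        (negBinPmf (β + j) c x * (x.descFactorial (k - i) : ℝ))) j (fun x => ?_) ?_
  · rw [mul_right_comm, negBinPmf_shift hc1, add_descFactorial, mul_assoc, Finset.mul_sum]
    congr 1
    exact Finset.sum_congr rfl fun i _ => by ring
  · exact (hasSum_sum fun i _ =>
      (hasSum_negBinPmf_mul_descFactorial hc hc1 (k - i)).mul_left _).mul_left _

lemma meixner_eq {β c : ℝ} (hβ : 0 < β) (hc : 0 < c) (hc1 : c < 1) (n x : ℕ) :
    meixner β c n x = Real.sqrt (c ^ n * poch β n / n.factorial) *
      altSum n (fun k => (x.descFactorial k : ℝ) / (poch β k * (c / (1 - c)) ^ k)) := by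
  have h1 : 0 < 1 - c := by linarith
  rw [meixner, altSum]
  congr 1
  refine Finset.sum_congr rfl fun k _ => ?_
  have h2 := (poch_pos hβ k).ne'
  have h3 : (1 - c⁻¹) ^ k = (-1) ^ k * ((1 - c) ^ k / c ^ k) := by
    rw [← div_pow, ← mul_pow]; congr 1; field_simp; ring
  have h4 : ((-1 : ℝ) ^ k) * (-1) ^ k = 1 := by rw [← mul_pow]; simp
  rw [poch_neg_natCast, poch_neg_natCast, h3, Nat.descFactorial_eq_factorial_mul_choose n, div_pow]
  push_cast
  field_simp
  linear_combination (n.choose k : ℝ) * (x.descFactorial k : ℝ) * h4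

/-- The weighted orthonormal Meixner polynomials. -/
lemma isL1Normalized_meixner {β c : ℝ} (hβ : 0 < β) (hc : 0 < c) (hc1 : c < 1) :
    IsL1Normalized Measure.count (fun n x => negBinPmf β c x * meixner β c n x) := by
  simp only [meixner_eq hβ hc hc1]
  have h1 : 0 < 1 - c := by linarith
  have hsum : ∀ j k, HasSum (fun x => negBinPmf β c x *
      ((x.descFactorial j : ℝ) / (poch β j * (c / (1 - c)) ^ j) *
        ((x.descFactorial k : ℝ) / (poch β k * (c / (1 - c)) ^ k))))
      ((∑ i ∈ Finset.range (k + 1), (k.choose i : ℝ) * (j.descFactorial i : ℝ) *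
        (poch (β + j) (k - i) * ((1 - c) / c) ^ i)) / poch β k) :=
      fun j k => by
    have hj := (poch_pos hβ j).ne'
    have hk := (poch_pos hβ k).ne'
    have hp : 0 < c / (1 - c) := by positivity
    have hinv : (1 - c) / c = (c / (1 - c))⁻¹ := by rw [inv_div]
    rw [hinv]
    have h := (hasSum_negBinPmf_mul_descFactorial_mul (β := β) hc hc1 j k).mul_left
      (poch β j * (c / (1 - c)) ^ j * (poch β k * (c / (1 - c)) ^ k))⁻¹
    generalize c / (1 - c) = r at h hp ⊢
    rw [Finset.mul_sum, Finset.mul_sum] at h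
    convert h.congr_fun (g := fun x => negBinPmf β c x * ((x.descFactorial j : ℝ) /
      (poch β j * r ^ j) * ((x.descFactorial k : ℝ) / (poch β k * r ^ k))))
      (fun x => by field_simp) using 1
    · rfl
    rw [Finset.sum_div]
    refine Finset.sum_congr rfl fun i hi => ?_
    have hi' : i ≤ k := by simpa [Nat.lt_succ_iff] using hi
    have : r ^ k = r ^ (k - i) * r ^ i := by rw [← pow_add]; congr; omega
    rw [this, inv_pow]
    field_simp
  have hnn : ∀ j k x, 0 ≤ negBinPmf β c x *
      ((x.descFactorial j : ℝ) / (poch β j * (c / (1 - c)) ^ j) *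
        ((x.descFactorial k : ℝ) / (poch β k * (c / (1 - c)) ^ k))) := fun j k x => by
    have := negBinPmf_nonneg hβ hc hc1 x
    have hj := poch_pos hβ j
    have hk := poch_pos hβ k
    positivity
  refine IsL1Normalized.of_moments
    (ψ := fun k x => (x.descFactorial k : ℝ) / (poch β k * (c / (1 - c)) ^ k))
    (h := fun n => (1 + (1 - c) / c) ^ n / poch β n)
    (s := fun n => Real.sqrt (c ^ n * poch β n / n.factorial))
    (.of_forall (negBinPmf_nonneg hβ hc hc1)) (by simp [poch_zero]) ?_ ?_ (by simp [poch_zero]) ?_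
  · exact fun j k => integrable_count_of_hasSum (hnn j k) (hsum j k)
  · intro n
    have h2 := poch_pos hβ n
    rw [Real.sq_sqrt (by positivity), show 1 + (1 - c) / c = c⁻¹ by field_simp; ring,
      inv_pow]
    field_simp
  · intro n j
    simp only [fun k => integral_count_of_hasSum (hnn j k) (hsum j k)]
    exact altSum_choose_mul_descFactorial_mul_poch n j hβ _

/-! ### Dependence of Lancaster laws -/

lemma IsL1Normalized.abs_setIntegral_le {E : Type*} [MeasurableSpace E] {ν : Measure E}
    {u : ℕ → E → ℝ} (hu : IsL1Normalized ν u) (n : ℕ) (S : Set E) :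
    |∫ x in S, u n x ∂ν| ≤ 1 :=
  (abs_integral_le_integral_abs).trans <|
    (setIntegral_le_integral (hu.integrable n).abs (.of_forall fun _ => abs_nonneg _)).trans
      (hu.integral_abs_le n)

section Kernel

variable {E F : Type*} [MeasurableSpace E] [MeasurableSpace F] {ν₁ : Measure E} {ν₂ : Measure F}
  [SFinite ν₁] [SFinite ν₂] {u : ℕ → E → ℝ} {v : ℕ → F → ℝ} {f : E → ℝ} {g : F → ℝ}
  {h : E × F → ℝ} {ρ : ℝ} {κ : Measure (ℝ × ℝ)}

/-- The probability of a rectangle under a law with a diagonal expansion. -/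
lemma hasSum_measureReal_prod (hu : IsL1Normalized ν₁ u) (hv : IsL1Normalized ν₂ v)
    (hf : Measurable f) (hg : Measurable g) (hρ : 0 ≤ ρ) (hρ1 : ρ < 1)
    (hh : ∀ z, h z = ∑' n, ρ ^ n * (u n z.1 * v n z.2))
    (hκ : HasJointDensity κ (ν₁.prod ν₂) (fun z => (f z.1, g z.2)) h)
    {A B : Set ℝ} (hA : MeasurableSet A) (hB : MeasurableSet B) :
    HasSum (fun n => ρ ^ n * ((∫ x in f ⁻¹' A, u n x ∂ν₁) * ∫ y in g ⁻¹' B, v n y ∂ν₂))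
      (κ.real (A ×ˢ B)) := by
  have hS := hf hA
  have hT := hg hB
  have hInt : ∀ n, Integrable (fun z : E × F => ρ ^ n * (u n z.1 * v n z.2)) (ν₁.prod ν₂) :=
    fun n => ((hu.integrable n).mul_prod (hv.integrable n)).const_mul _
  have hmeas : AEMeasurable h (ν₁.prod ν₂) := by
    rw [funext hh]
    exact AEMeasurable.tsum fun n => (hInt n).aemeasurable
  have hset : (fun z : E × F => (f z.1, g z.2)) ⁻¹' (A ×ˢ B) = (f ⁻¹' A) ×ˢ (g ⁻¹' B) := rfl
  have hreal : κ.real (A ×ˢ B) =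
      ∫ z in (f ⁻¹' A) ×ˢ (g ⁻¹' B), h z ∂(ν₁.prod ν₂) := by
    rw [measureReal_def, hκ.2, Measure.map_apply (by fun_prop) (hA.prod hB), hset,
      withDensity_apply _ (hS.prod hT), integral_eq_lintegral_of_nonneg_ae
        (ae_restrict_of_ae hκ.1) hmeas.restrict.aestronglyMeasurable]
  -- The `n`-th term has `L¹`-norm at most `ρ ^ n`, so the geometric series justifies integrating
  -- term by term.
  have hnorm : ∀ n, ∫ z in (f ⁻¹' A) ×ˢ (g ⁻¹' B), ‖ρ ^ n * (u n z.1 * v n z.2)‖ ∂(ν₁.prod ν₂)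
      ≤ ρ ^ n := fun n => by
    refine (setIntegral_le_integral (hInt n).norm (.of_forall fun _ => norm_nonneg _)).trans ?_
    simp only [norm_mul, Real.norm_eq_abs, abs_of_nonneg (pow_nonneg hρ n)]
    rw [integral_const_mul, integral_prod_mul (fun x => |u n x|) (fun y => |v n y|)]
    refine mul_le_of_le_one_right (pow_nonneg hρ n) ?_
    exact mul_le_one₀ (hu.integral_abs_le n) (integral_nonneg fun _ => abs_nonneg _)
      (hv.integral_abs_le n)
  have key := hasSum_integral_of_summable_integral_norm (fun n => (hInt n).restrict)
    (Summable.of_nonneg_of_le (fun n => integral_nonneg fun _ => norm_nonneg _) hnorm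
      (summable_geometric_of_lt_one hρ hρ1))
  simp only [integral_const_mul, setIntegral_prod_mul, ← hh] at key
  rw [hreal]
  exact key

/-- The product is the term `n = 0`; the tail is at most `ρ / (1 - ρ)`, which is at most `2 * ρ`
when `ρ ≤ 1 / 2`. -/
lemma abs_measureReal_prod_sub_le (hu : IsL1Normalized ν₁ u) (hv : IsL1Normalized ν₂ v)
    (hf : Measurable f) (hg : Measurable g) (hρ : 0 ≤ ρ) (hρ1 : ρ ≤ 1 / 2)
    (hh : ∀ z, h z = ∑' n, ρ ^ n * (u n z.1 * v n z.2))
    (hκ : HasJointDensity κ (ν₁.prod ν₂) (fun z => (f z.1, g z.2)) h)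
    {A B : Set ℝ} (hA : MeasurableSet A) (hB : MeasurableSet B) :
    |κ.real (A ×ˢ B) - (∫ x in f ⁻¹' A, u 0 x ∂ν₁) * ∫ y in g ⁻¹' B, v 0 y ∂ν₂| ≤ 2 * ρ := by
  have hsum := hasSum_measureReal_prod hu hv hf hg hρ (by linarith) hh hκ hA hB
  rw [← hasSum_nat_add_iff' 1] at hsum
  simp only [Finset.range_one, Finset.sum_singleton, pow_zero, one_mul] at hsum
  have hgeo : HasSum (fun n => ρ ^ (n + 1)) (ρ * (1 - ρ)⁻¹) := by
    simpa only [pow_succ'] using (hasSum_geometric_of_lt_one hρ (by linarith)).mul_left ρ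
  rw [← hsum.tsum_eq, ← Real.norm_eq_abs]
  refine (tsum_of_norm_bounded hgeo fun n => ?_).trans ?_
  · rw [Real.norm_eq_abs, abs_mul, abs_mul, abs_of_nonneg (pow_nonneg hρ _)]
    exact mul_le_of_le_one_right (pow_nonneg hρ _) <|
      mul_le_one₀ (hu.abs_setIntegral_le _ _) (abs_nonneg _) (hv.abs_setIntegral_le _ _)
  · have : (1 - ρ)⁻¹ ≤ 2 := by
      rw [inv_le_comm₀ (by linarith) (by norm_num)]
      linarith
    nlinarith

/-- Under a law with a diagonal expansion, the dependence of the coordinates is at most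
proportional to `ρ`. -/
theorem abs_measureReal_prod_sub_mul_le [IsProbabilityMeasure κ] (hu : IsL1Normalized ν₁ u)
    (hv : IsL1Normalized ν₂ v) (hf : Measurable f) (hg : Measurable g) (hρ : 0 ≤ ρ)
    (hh : ∀ z, h z = ∑' n, ρ ^ n * (u n z.1 * v n z.2))
    (hκ : HasJointDensity κ (ν₁.prod ν₂) (fun z => (f z.1, g z.2)) h)
    {A B : Set ℝ} (hA : MeasurableSet A) (hB : MeasurableSet B) :
    |κ.real (A ×ˢ B) - κ.real (A ×ˢ Set.univ) * κ.real (Set.univ ×ˢ B)| ≤ 6 * ρ := by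
  have hn : ∀ S, 0 ≤ κ.real S := fun _ => measureReal_nonneg
  have ho : ∀ S, κ.real S ≤ 1 := fun _ => measureReal_le_one
  rcases le_or_gt ρ (1 / 2) with hρ1 | hρ1
  · have h1 := abs_measureReal_prod_sub_le hu hv hf hg hρ hρ1 hh hκ hA hB
    have h2 := abs_measureReal_prod_sub_le hu hv hf hg hρ hρ1 hh hκ hA MeasurableSet.univ
    have h3 := abs_measureReal_prod_sub_le hu hv hf hg hρ hρ1 hh hκ MeasurableSet.univ hB
    simp only [Set.preimage_univ, Measure.restrict_univ, hu.integral_zero, hv.integral_zero,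
      mul_one, one_mul] at h2 h3
    have hb := hv.abs_setIntegral_le 0 (g ⁻¹' B)
    set a := ∫ x in f ⁻¹' A, u 0 x ∂ν₁
    set b := ∫ y in g ⁻¹' B, v 0 y ∂ν₂
    -- The marginals of `κ` are not computed, only compared with `a` and `b` up to `2 * ρ`. Three
    -- such errors give the constant `6`.
    calc |κ.real (A ×ˢ B) - κ.real (A ×ˢ Set.univ) * κ.real (Set.univ ×ˢ B)|
        = |(κ.real (A ×ˢ B) - a * b) - (κ.real (A ×ˢ Set.univ) - a) * b -
            κ.real (A ×ˢ Set.univ) * (κ.real (Set.univ ×ˢ B) - b)| := by congr 1; ring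
      _ ≤ |κ.real (A ×ˢ B) - a * b| + |κ.real (A ×ˢ Set.univ) - a| * |b| +
            |κ.real (A ×ˢ Set.univ)| * |κ.real (Set.univ ×ˢ B) - b| := by
          rw [← abs_mul, ← abs_mul]
          exact (abs_sub _ _).trans (by gcongr; exact abs_sub _ _)
      _ ≤ 2 * ρ + 2 * ρ * 1 + 1 * (2 * ρ) := by
          gcongr
          rw [abs_of_nonneg (hn _)]
          exact ho _
      _ = 6 * ρ := by ring
  -- For `ρ > 1 / 2` the difference of two numbers in `[0, 1]` is already below `6 * ρ`. This covers
  -- `ρ = 1` in the Poisson case, where the geometric bound fails.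
  · rw [abs_le]
    have h1 := mul_nonneg (hn (A ×ˢ Set.univ)) (hn (Set.univ ×ˢ B))
    have h2 := mul_le_one₀ (ho (A ×ˢ Set.univ)) (hn (Set.univ ×ˢ B)) (ho _)
    constructor <;> linarith [hn (A ×ˢ B), ho (A ×ˢ B)]

end Kernel

instance : SFinite lebPos := by unfold lebPos; infer_instance

theorem IsLancaster.nonneg {ρ : ℝ} {κ : Measure (ℝ × ℝ)} (h : IsLancaster ρ κ) : 0 ≤ ρ := by
  rcases h with ⟨α, _, _, h⟩ | ⟨a, _, h⟩ | ⟨β, c, _, _, _, h⟩ | ⟨β, c, α, _, _, _, _, h⟩ <;>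
    exact h.1

/-- The dependence of events under a Lancaster law is at most proportional to the correlation. -/
theorem IsLancaster.abs_measureReal_prod_sub_mul_le {ρ : ℝ} {κ : Measure (ℝ × ℝ)}
    [IsProbabilityMeasure κ] (h : IsLancaster ρ κ)
    {A B : Set ℝ} (hA : MeasurableSet A) (hB : MeasurableSet B) :
    |κ.real (A ×ˢ B) - κ.real (A ×ˢ Set.univ) * κ.real (Set.univ ×ˢ B)| ≤ 6 * ρ := by
  have hcast : Measurable (fun n : ℕ => (n : ℝ)) := measurable_of_countable _
  rcases h with ⟨α, hα, _, hρ, _, h⟩ | ⟨a, ha, hρ, _, h⟩ | ⟨β, c, hβ, hc, hc1, hρ, _, h⟩ |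
    ⟨β, c, α, hβ, hc, hc1, hα, hρ, _, h⟩
  · refine Lancaster.abs_measureReal_prod_sub_mul_le (isL1Normalized_laguerre hα)
      (isL1Normalized_laguerre hα) measurable_id measurable_id hρ (fun z => ?_) h hA hB
    rw [gammaJoint, ← tsum_mul_left]
    refine tsum_congr fun n => ?_
    have h1 := poch_pos hα n
    -- The coefficient `n! / poch α n` is shared equally between the two coordinates, one square
    -- root each.
    have h2 := Real.mul_self_sqrt (show 0 ≤ (n.factorial : ℝ) / poch α n by positivity)
    have h3 : (n.factorial : ℝ) * Real.Gamma α / Real.Gamma (α + n) = n.factorial / poch α n := by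
      have := Real.Gamma_pos_of_pos hα
      rw [Gamma_add_natCast hα]
      field_simp
    rw [h3]
    linear_combination -(gammaDensity α z.1 * gammaDensity α z.2 * ρ ^ n *
      laguerre (α - 1) n z.1 * laguerre (α - 1) n z.2) * h2
  · refine Lancaster.abs_measureReal_prod_sub_mul_le (isL1Normalized_charlier ha)
      (isL1Normalized_charlier ha) hcast hcast hρ (fun z => ?_) h hA hB
    rw [poissonJoint, ← tsum_mul_left]
    exact tsum_congr fun n => by ring
  · refine Lancaster.abs_measureReal_prod_sub_mul_le (isL1Normalized_meixner hβ hc hc1)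
      (isL1Normalized_meixner hβ hc hc1) hcast hcast hρ (fun z => ?_) h hA hB
    rw [negBinJoint, ← tsum_mul_left]
    exact tsum_congr fun n => by ring
  · refine Lancaster.abs_measureReal_prod_sub_mul_le (isL1Normalized_meixner hβ hc hc1)
      (isL1Normalized_laguerre hα) hcast measurable_id hρ (fun z => ?_) h hA hB
    rw [gammaNegBinJoint, ← tsum_mul_left]
    exact tsum_congr fun n => by ring

/-! ### A strong law for bounded, weakly correlated variables -/

section StrongLaw

variable {Ω : Type*} [MeasurableSpace Ω] {P : Measure Ω}

/-- The sum of the `Y k` has finite expectation, so it converges almost surely and its terms tend to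
zero. -/
lemma ae_tendsto_zero_of_summable_integral {Y : ℕ → Ω → ℝ} (hY : ∀ k, Integrable (Y k) P)
    (hnn : ∀ k ω, 0 ≤ Y k ω) (hsum : Summable fun k => ∫ ω, Y k ω ∂P) :
    ∀ᵐ ω ∂P, Tendsto (fun k => Y k ω) atTop (𝓝 0) := by
  have hm : ∀ k, AEMeasurable (fun ω => ENNReal.ofReal (Y k ω)) P := fun k =>
    (hY k).aemeasurable.ennreal_ofReal
  have hfin : ∫⁻ ω, ∑' k, ENNReal.ofReal (Y k ω) ∂P ≠ ⊤ := by
    rw [lintegral_tsum hm]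
    simp only [← fun k => ofReal_integral_eq_lintegral_ofReal (hY k) (.of_forall (hnn k))]
    rw [← ENNReal.ofReal_tsum_of_nonneg (fun k => integral_nonneg (hnn k)) hsum]
    exact ENNReal.ofReal_ne_top
  filter_upwards [ae_lt_top' (AEMeasurable.tsum hm) hfin] with ω hω
  have h := (ENNReal.tendsto_toReal ENNReal.zero_ne_top).comp
    (ENNReal.tendsto_atTop_zero_of_tsum_ne_top hω.ne)
  simpa [Function.comp_def, ENNReal.toReal_ofReal (hnn _ _)] using h

lemma eventually_succ_pow_le (q : ℕ) {a : ℝ} (ha : 1 < a) :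
    ∀ᶠ k : ℕ in atTop, (((k + 1) ^ q : ℕ) : ℝ) ≤ a * ((k ^ q : ℕ) : ℝ) := by
  have h1 : Tendsto (fun k : ℕ => (1 + 1 / (k : ℝ)) ^ q) atTop (𝓝 1) := by
    simpa using ((tendsto_one_div_atTop_nhds_zero_nat (𝕜 := ℝ)).const_add 1).pow q
  filter_upwards [h1.eventually_le_const ha, eventually_gt_atTop 0] with k hk hk0
  have hk0' : (0 : ℝ) < k := by exact_mod_cast hk0
  have h2 : ((k : ℝ) + 1) ^ q = (1 + 1 / (k : ℝ)) ^ q * (k : ℝ) ^ q := by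
    rw [← mul_pow]; congr 1; field_simp
  push_cast
  rw [h2]
  gcongr

lemma integral_sum_sq_le [IsProbabilityMeasure P] {X : ℕ → Ω → ℝ} (hX : ∀ i, Measurable (X i))
    (hb : ∀ i ω, |X i ω| ≤ 1) {r : ℕ → ℕ → ℝ} (hr : ∀ i j, 0 ≤ r i j)
    (hcov : ∀ i j, i ≠ j → |∫ ω, X i ω * X j ω ∂P| ≤ r i j) (m : ℕ) :
    ∫ ω, (∑ i ∈ Finset.range m, X i ω) ^ 2 ∂P ≤
      m + ∑ i ∈ Finset.range m, ∑ j ∈ Finset.range m, r i j := by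
  have hbb : ∀ i j ω, ‖X i ω * X j ω‖ ≤ 1 := fun i j ω => by
    rw [Real.norm_eq_abs, abs_mul]
    exact mul_le_one₀ (hb i ω) (abs_nonneg _) (hb j ω)
  have hInt : ∀ i j, Integrable (fun ω => X i ω * X j ω) P := fun i j =>
    Integrable.of_bound ((hX i).mul (hX j)).aestronglyMeasurable 1 (.of_forall (hbb i j))
  simp only [sq, Finset.sum_mul_sum]
  rw [integral_finsetSum _ fun i _ => integrable_finsetSum _ fun j _ => hInt i j]
  have hle : ∀ i j, ∫ ω, X i ω * X j ω ∂P ≤ (if i = j then 1 else 0) + r i j := fun i j => by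
    split_ifs with hij
    · have := norm_integral_le_of_norm_le_const (μ := P) (.of_forall (hbb i j))
      rw [probReal_univ, mul_one] at this
      linarith [le_of_abs_le this, hr i j]
    · linarith [le_of_abs_le (hcov i j hij)]
  calc ∑ i ∈ Finset.range m, ∫ ω, ∑ j ∈ Finset.range m, X i ω * X j ω ∂P
      = ∑ i ∈ Finset.range m, ∑ j ∈ Finset.range m, ∫ ω, X i ω * X j ω ∂P :=
        Finset.sum_congr rfl fun i _ => integral_finsetSum _ fun j _ => hInt i j
    _ ≤ ∑ i ∈ Finset.range m, ∑ j ∈ Finset.range m, ((if i = j then 1 else 0) + r i j) :=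
        Finset.sum_le_sum fun i _ => Finset.sum_le_sum fun j _ => hle i j
    _ = m + ∑ i ∈ Finset.range m, ∑ j ∈ Finset.range m, r i j := by
        simp only [Finset.sum_add_distrib, Finset.sum_ite_eq]
        congr 1
        rw [Finset.sum_congr rfl fun i hi => if_pos hi]
        simp

/-- **Strong law of large numbers** for bounded variables whose average mixed second moment
decays polynomially. -/
theorem ae_tendsto_average_zero [IsProbabilityMeasure P] {X : ℕ → Ω → ℝ}
    (hX : ∀ i, Measurable (X i)) (hb : ∀ i ω, |X i ω| ≤ 1) {r : ℕ → ℕ → ℝ}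
    (hr : ∀ i j, 0 ≤ r i j) (hcov : ∀ i j, i ≠ j → |∫ ω, X i ω * X j ω ∂P| ≤ r i j)
    {δ : ℝ} (hδ : 0 < δ)
    (hO : (fun m : ℕ => ((m : ℝ) ^ 2)⁻¹ * ∑ i ∈ Finset.range m, ∑ j ∈ Finset.range m, r i j)
      =O[atTop] fun m : ℕ => (m : ℝ) ^ (-δ)) :
    ∀ᵐ ω ∂P, Tendsto (fun m : ℕ => (m : ℝ)⁻¹ * ∑ i ∈ Finset.range m, X i ω) atTop (𝓝 0) := by
  -- The diagonal terms contribute `m⁻¹` to the second moment of the average, so no decay beyond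
  -- exponent one is available. Then `q > 1 / ε` makes `k ^ (-(q * ε))` summable.
  set ε := min δ 1 with hε
  have hε0 : 0 < ε := lt_min hδ one_pos
  obtain ⟨q, hq⟩ := exists_nat_gt (1 / ε)
  have hqε : 1 < q * ε := by rwa [div_lt_iff₀ hε0] at hq
  have hq0 : q ≠ 0 := by rintro rfl; simp at hqε; linarith
  set e : ℕ → ℝ := fun m => ∫ ω, ((m : ℝ)⁻¹ * ∑ i ∈ Finset.range m, X i ω) ^ 2 ∂P
  have hmono : ∀ s, ε ≤ s → (fun m : ℕ => (m : ℝ) ^ (-s)) =O[atTop] fun m : ℕ => (m : ℝ) ^ (-ε) :=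
    fun s hs => by
      refine IsBigO.of_bound 1 ?_
      filter_upwards [eventually_ge_atTop 1] with m hm
      have hm' : (1 : ℝ) ≤ m := by exact_mod_cast hm
      rw [one_mul, Real.norm_of_nonneg (by positivity), Real.norm_of_nonneg (by positivity)]
      exact Real.rpow_le_rpow_of_exponent_le hm' (by linarith)
  have heO : e =O[atTop] fun m : ℕ => (m : ℝ) ^ (-ε) := by
    have h1 : (fun m : ℕ => (m : ℝ) ^ (-(1 : ℝ)) + ((m : ℝ) ^ 2)⁻¹ *
        ∑ i ∈ Finset.range m, ∑ j ∈ Finset.range m, r i j) =O[atTop]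
        fun m : ℕ => (m : ℝ) ^ (-ε) :=
      (hmono 1 (min_le_right _ _)).add (hO.trans (hmono δ (min_le_left _ _)))
    refine IsBigO.trans (IsBigO.of_bound 1 ?_) h1
    filter_upwards [eventually_ge_atTop 1] with m hm
    have hm' : (0 : ℝ) < m := by exact_mod_cast hm
    have hrr : 0 ≤ ∑ i ∈ Finset.range m, ∑ j ∈ Finset.range m, r i j :=
      Finset.sum_nonneg fun i _ => Finset.sum_nonneg fun j _ => hr i j
    rw [one_mul, Real.norm_of_nonneg (integral_nonneg fun ω => sq_nonneg _),
      Real.norm_of_nonneg (by positivity)]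
    simp only [mul_pow]
    rw [integral_const_mul]
    calc (m : ℝ)⁻¹ ^ 2 * ∫ ω, (∑ i ∈ Finset.range m, X i ω) ^ 2 ∂P
        ≤ (m : ℝ)⁻¹ ^ 2 * (m + ∑ i ∈ Finset.range m, ∑ j ∈ Finset.range m, r i j) := by
          gcongr
          exact integral_sum_sq_le hX hb hr hcov m
      _ = _ := by
          rw [Real.rpow_neg_one]
          field_simp
  have htend : Tendsto (fun k : ℕ => k ^ q) atTop atTop := tendsto_pow_atTop hq0
  have hsum : Summable fun k : ℕ => e (k ^ q) := by
    refine summable_of_isBigO_nat (Real.summable_nat_rpow.2 (show -(q * ε) < -1 by linarith)) ?_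
    refine (heO.comp_tendsto htend).congr_right fun k => ?_
    simp only [Function.comp_apply, Nat.cast_pow]
    rw [← Real.rpow_natCast, ← Real.rpow_mul (by positivity), mul_neg]
  have hSb : ∀ (m : ℕ) ω, ‖((m : ℝ)⁻¹ * ∑ i ∈ Finset.range m, X i ω) ^ 2‖ ≤ 1 := fun m ω => by
    rw [norm_pow]
    refine pow_le_one₀ (norm_nonneg _) ?_
    rw [norm_mul, norm_inv, RCLike.norm_natCast]
    refine (mul_le_mul_of_nonneg_left ((norm_sum_le _ _).trans
      (Finset.sum_le_sum fun i _ => hb i ω)) (by positivity)).trans ?_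
    simp only [Finset.sum_const, Finset.card_range, nsmul_eq_mul, mul_one]
    exact inv_mul_le_one
  have hInt : ∀ m : ℕ, Integrable (fun ω => ((m : ℝ)⁻¹ * ∑ i ∈ Finset.range m, X i ω) ^ 2) P :=
    fun m => Integrable.of_bound (Measurable.aestronglyMeasurable <| by fun_prop) 1
      (.of_forall (hSb m))
  filter_upwards [ae_tendsto_zero_of_summable_integral (fun k => hInt (k ^ q))
    (fun k ω => sq_nonneg _) hsum] with ω hω
  have hsub : Tendsto (fun k : ℕ => ((k ^ q : ℕ) : ℝ)⁻¹ * ∑ i ∈ Finset.range (k ^ q), X i ω)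
      atTop (𝓝 0) := by
    rw [tendsto_zero_iff_abs_tendsto_zero]
    simpa [Function.comp_def, Real.sqrt_sq_eq_abs] using hω.sqrt
  -- Adding one to each `X i` makes the partial sums monotone. Convergence of `S m / m` along `k ^
  -- q`, whose consecutive ratios tend to one, then extends to all `m`.
  set S : ℕ → ℝ := fun m => ∑ i ∈ Finset.range m, (X i ω + 1) with hS
  have hSdiv : ∀ m : ℕ, m ≠ 0 → S m / m = (m : ℝ)⁻¹ * ∑ i ∈ Finset.range m, X i ω + 1 := by
    intro m hm
    have : (m : ℝ) ≠ 0 := by exact_mod_cast hm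
    simp only [hS, Finset.sum_add_distrib, Finset.sum_const, Finset.card_range, nsmul_eq_mul]
    field_simp
  have hSmono : Monotone S := monotone_nat_of_le_succ fun m => by
    simp only [hS, Finset.sum_range_succ]
    linarith [neg_le_of_abs_le (hb m ω)]
  have hlim : Tendsto (fun m => S m / m) atTop (𝓝 1) := by
    refine tendsto_div_of_monotone_of_exists_subseq_tendsto_div S 1 hSmono fun a ha =>
      ⟨fun k => k ^ q, eventually_succ_pow_le q ha, htend, ?_⟩
    have h2 := hsub.add_const 1
    rw [zero_add] at h2
    refine h2.congr' ?_
    filter_upwards [eventually_gt_atTop 0] with k hk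
    exact (hSdiv _ (pow_ne_zero q hk.ne')).symm
  have h3 := hlim.sub_const 1
  rw [sub_self] at h3
  refine h3.congr' ?_
  filter_upwards [eventually_gt_atTop 0] with m hm
  rw [hSdiv m hm.ne', add_sub_cancel_right]

end StrongLaw

/-! ### Rejection indicators -/

namespace TestingProblem

variable {Ω : Type*} [MeasurableSpace Ω] {P : Measure Ω} (T : TestingProblem P)

/-- The values of the `i`-th statistic that lead to a rejection. -/
def rejectionRegion (t : ℝ) (i : ℕ) : Set ℝ := {x | 1 - cdf (T.law i T.μ₀) x ≤ t}

lemma measurableSet_rejectionRegion (t : ℝ) (i : ℕ) : MeasurableSet (T.rejectionRegion t i) :=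
  measurableSet_le ((monotone_cdf _).measurable.const_sub 1) measurable_const

lemma reject_eq (t : ℝ) (i : ℕ) :
    T.reject t i = (T.ζ i ⁻¹' T.rejectionRegion t i).indicator 1 := rfl

lemma measurableSet_reject (t : ℝ) (i : ℕ) : MeasurableSet (T.ζ i ⁻¹' T.rejectionRegion t i) :=
  T.measurable_ζ i (T.measurableSet_rejectionRegion t i)

lemma measurable_reject (t : ℝ) (i : ℕ) : Measurable (T.reject t i) :=
  measurable_one.indicator (T.measurableSet_reject t i)

lemma reject_mem_Icc (t : ℝ) (i : ℕ) (ω : Ω) : T.reject t i ω ∈ Set.Icc (0 : ℝ) 1 := by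
  rw [reject_eq]
  by_cases h : ω ∈ T.ζ i ⁻¹' T.rejectionRegion t i <;> simp [h]

lemma integrable_reject [IsProbabilityMeasure P] (t : ℝ) (i : ℕ) :
    Integrable (T.reject t i) P :=
  Integrable.of_bound (T.measurable_reject t i).aestronglyMeasurable 1 <| .of_forall fun ω => by
    have := T.reject_mem_Icc t i ω
    rw [Real.norm_of_nonneg this.1]
    exact this.2

lemma integral_reject_mem_Icc [IsProbabilityMeasure P] (t : ℝ) (i : ℕ) :
    ∫ ω, T.reject t i ω ∂P ∈ Set.Icc (0 : ℝ) 1 := by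
  rw [reject_eq, integral_indicator_one (T.measurableSet_reject t i)]
  exact ⟨measureReal_nonneg, measureReal_le_one⟩

lemma covariance_reject [IsProbabilityMeasure P] (t : ℝ) (i j : ℕ) :
    cov[T.reject t i, T.reject t j; P] =
      P.real (T.ζ i ⁻¹' T.rejectionRegion t i ∩ T.ζ j ⁻¹' T.rejectionRegion t j) -
        P.real (T.ζ i ⁻¹' T.rejectionRegion t i) * P.real (T.ζ j ⁻¹' T.rejectionRegion t j) := by
  have hmem : ∀ i, MemLp (T.reject t i) 2 P := fun i =>
    memLp_indicator_const 2 (T.measurableSet_reject t i) (1 : ℝ) (.inr (measure_ne_top _ _))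
  rw [covariance_eq_sub (hmem i) (hmem j), reject_eq, reject_eq, ← Set.inter_indicator_one,
    integral_indicator_one (T.measurableSet_reject t i),
    integral_indicator_one (T.measurableSet_reject t j),
    integral_indicator_one ((T.measurableSet_reject t i).inter (T.measurableSet_reject t j))]

lemma abs_covariance_reject_le_of_isLancaster [IsProbabilityMeasure P] (t : ℝ) (i j : ℕ) {ρ : ℝ}
    (h : IsLancaster ρ (P.map fun ω => (T.ζ i ω, T.ζ j ω))) :
    |cov[T.reject t i, T.reject t j; P]| ≤ 6 * |ρ| := by
  have hm : Measurable fun ω => (T.ζ i ω, T.ζ j ω) := (T.measurable_ζ i).prodMk (T.measurable_ζ j)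
  have hA := T.measurableSet_rejectionRegion t i
  have hB := T.measurableSet_rejectionRegion t j
  have := Measure.isProbabilityMeasure_map (μ := P) hm.aemeasurable
  have key := h.abs_measureReal_prod_sub_mul_le hA hB
  rw [map_measureReal_apply hm (hA.prod hB), map_measureReal_apply hm (hA.prod .univ),
    map_measureReal_apply hm (MeasurableSet.univ.prod hB), Set.mk_preimage_prod,
    Set.mk_preimage_prod, Set.mk_preimage_prod] at key
  simp only [Set.preimage_univ, Set.inter_univ, Set.univ_inter] at key
  rwa [covariance_reject, abs_of_nonneg h.nonneg]

lemma abs_covariance_reject_le [IsProbabilityMeasure P] (hT : T.PairwiseLancaster) (t : ℝ)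
    {i j : ℕ} (hij : i ≠ j) :
    |cov[T.reject t i, T.reject t j; P]| ≤ 6 * |T.ρ i j| := by
  rcases hT i j hij with h | h
  · exact T.abs_covariance_reject_le_of_isLancaster t i j h
  · rw [covariance_comm]
    exact T.abs_covariance_reject_le_of_isLancaster t j i h

/-- The centred average of the rejection indicators over any set of indices vanishes almost
surely in the limit. -/
theorem ae_tendsto_average_filter [IsProbabilityMeasure P] (hT : T.PairwiseLancaster) (t : ℝ)
    {δ : ℝ} (hδ : 0 < δ) (hO : (fun m : ℕ => ((m : ℝ) ^ 2)⁻¹ * T.corrNorm m) =O[atTop]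
      fun m : ℕ => (m : ℝ) ^ (-δ)) (p : ℕ → Prop) [DecidablePred p] :
    ∀ᵐ ω ∂P, Tendsto (fun m : ℕ => (m : ℝ)⁻¹ *
      (∑ i ∈ Finset.range m with p i, T.reject t i ω -
        ∫ ω', ∑ i ∈ Finset.range m with p i, T.reject t i ω' ∂P)) atTop (𝓝 0) := by
  -- Setting the excluded variables to zero keeps the full range and the full correlation norm, so
  -- the strong law applies without reindexing.
  set X : ℕ → Ω → ℝ := fun i ω =>
    if p i then T.reject t i ω - ∫ ω', T.reject t i ω' ∂P else 0 with hX
  have hmeas : ∀ i, Measurable (X i) := fun i => by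
    by_cases hi : p i
    · simpa [hX, hi] using (T.measurable_reject t i).sub_const _
    · simp [hX, hi]
  have hb : ∀ i ω, |X i ω| ≤ 1 := fun i ω => by
    have h1 := T.reject_mem_Icc t i ω
    have h2 := T.integral_reject_mem_Icc t i
    by_cases hi : p i
    · simp only [hX, hi, if_true]
      rw [abs_le]
      constructor <;> linarith [h1.1, h1.2, h2.1, h2.2]
    · simp [hX, hi]
  have hcov : ∀ i j, i ≠ j → |∫ ω, X i ω * X j ω ∂P| ≤ 6 * |T.ρ i j| := fun i j hij => by
    by_cases hi : p i
    · by_cases hj : p j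
      · simp only [hX, hi, hj, if_true]
        exact T.abs_covariance_reject_le hT t hij
      · simp [hX, hj]
    · simp [hX, hi]
  have hO' : (fun m : ℕ => ((m : ℝ) ^ 2)⁻¹ *
      ∑ i ∈ Finset.range m, ∑ j ∈ Finset.range m, 6 * |T.ρ i j|) =O[atTop]
      fun m : ℕ => (m : ℝ) ^ (-δ) := by
    refine (hO.const_mul_left 6).congr_left fun m => ?_
    simp only [corrNorm, ← Finset.mul_sum]
    ring
  filter_upwards [ae_tendsto_average_zero hmeas hb (fun i j => by positivity) hcov hδ hO'] with ω hω
  refine hω.congr fun m => ?_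
  rw [integral_finsetSum _ fun i _ => T.integrable_reject t i, ← Finset.sum_sub_distrib,
    Finset.sum_filter]

end TestingProblem

end Lancaster

/-! ### The main theorem -/

theorem theorem1 (t : ℝ) (ht : t ∈ Set.Icc (0 : ℝ) 1) :
    ∃ C : ℝ, 0 < C ∧
      ∀ (Ω : Type*) [MeasurableSpace Ω] (P : Measure Ω) [IsProbabilityMeasure P]
        (T : Lancaster.TestingProblem P), T.PairwiseLancaster →
        (∀ i j : ℕ, i ≠ j → |cov[T.reject t i, T.reject t j; P]| ≤ C * |T.ρ i j|) ∧
        ((∃ δ : ℝ, 0 < δ ∧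
            (fun m : ℕ => ((m : ℝ) ^ 2)⁻¹ * T.corrNorm m) =O[atTop]
              fun m : ℕ => (m : ℝ) ^ (-δ)) →
          (Lancaster.ConvergesToMean P (fun m ω => (m : ℝ)⁻¹ * T.R t m ω) ∧
            Lancaster.ConvergesToMean P (fun m ω => (m : ℝ)⁻¹ * T.V t m ω)) ∧
          (0 < liminf (fun m : ℕ => (T.m₀ m : ℝ) / (m : ℝ)) atTop →
            Lancaster.ConvergesToMean P (fun m ω => (T.m₀ m : ℝ)⁻¹ * T.V t m ω))) := by
  classical
  refine ⟨6, by norm_num, fun Ω _ P _ T hT => ⟨fun i j hij => T.abs_covariance_reject_le hT t hij,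
    fun ⟨δ, hδ, hO⟩ => ?_⟩⟩
  have hR := T.ae_tendsto_average_filter hT t hδ hO (fun _ => True)
  have hV := T.ae_tendsto_average_filter hT t hδ hO (fun i => T.μ i = T.μ₀)
  have hVeq : ∀ m ω, T.V t m ω =
      ∑ i ∈ Finset.range m with T.μ i = T.μ₀, T.reject t i ω := fun m ω => by
    simp only [Lancaster.TestingProblem.V, Lancaster.TestingProblem.trueNulls]
  simp only [← hVeq] at hV
  refine ⟨⟨?_, ?_⟩, fun hlim => ?_⟩
  · filter_upwards [hR] with ω hω
    rw [tendsto_zero_iff_abs_tendsto_zero] at hω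
    refine hω.congr fun m => ?_
    simp [Lancaster.TestingProblem.R, integral_const_mul, mul_sub]
  · filter_upwards [hV] with ω hω
    rw [tendsto_zero_iff_abs_tendsto_zero] at hω
    refine hω.congr fun m => ?_
    simp [integral_const_mul, mul_sub]
  · obtain ⟨ε, hε, hεlim⟩ := exists_between hlim
    -- A real `liminf` gives eventual lower bounds only for a sequence bounded below. With `ε * m <
    -- m₀` eventually, part (c) reduces to the limit for `V` divided by `m`.
    have hbdd : IsBoundedUnder (· ≥ ·) atTop fun m : ℕ => (T.m₀ m : ℝ) / (m : ℝ) :=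
      isBoundedUnder_of ⟨0, fun m => by positivity⟩
    have hev := eventually_lt_of_lt_liminf hεlim hbdd
    filter_upwards [hV] with ω hω
    rw [tendsto_zero_iff_abs_tendsto_zero] at hω
    have hω' := hω.const_mul ε⁻¹
    rw [mul_zero] at hω'
    refine squeeze_zero' (.of_forall fun m => abs_nonneg _) ?_ hω'
    filter_upwards [hev, eventually_gt_atTop 0] with m hm hm0
    have hm0' : (0 : ℝ) < m := by exact_mod_cast hm0
    rw [lt_div_iff₀ hm0'] at hm
    have hinv : (T.m₀ m : ℝ)⁻¹ ≤ ε⁻¹ * (m : ℝ)⁻¹ := by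
      rw [← mul_inv]
      exact inv_anti₀ (by positivity) hm.le
    simp only [Function.comp_apply]
    rw [integral_const_mul, ← mul_sub, abs_mul, abs_mul,
      abs_of_nonneg (show (0 : ℝ) ≤ (T.m₀ m : ℝ)⁻¹ by positivity),
      abs_of_nonneg (show (0 : ℝ) ≤ (m : ℝ)⁻¹ by positivity), ← mul_assoc]
    gcongr
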